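/- Let $p$ be a prime, $K\ge 1$, and $d,m,m'\ge 0$ integers. An instance of the symmetric linear computation broadcast problem (LCBC) over $\mathbb F_q$, $q=p^n$, consists of matrices ${\bf v}_k\in\mathbb F_q^{d\times m}$ and ${\bf v}_k'\in\mathbb F_q^{d\times m'}$, $k=1,\dots,K$. An achievable scheme consists of a batch size $L\ge 1$, a finite alphabet $\mathcal S$, an encoder $\Phi$ mapping the data ${\bf x}\in\mathbb F_q^{d\times L}$ to $\mathcal S$, and decoders $\Psi_k:\mathcal S\times\mathbb F_q^{L\times m'}\to\mathbb F_q^{L\times m}$ (all arbitrary functions) with $\Psi_k(\Phi({\bf x}),{\bf x}^T{\bf v}_k')={\bf x}^T{\bf v}_k$ for all ${\bf x}$ and all $k$; its cost is $\log_q|\mathcal S|/L$. The optimal cost $\Delta^*$ of an instance is the infimum of the costs of its achievable schemes. Let $\Lambda_n$ be a uniformly random instance over $\mathbb F_{p^n}$ (with $p,K,d,m,m'$ fixed). The generic cost $\Delta_g$, if it exists, is the number to which $\Delta^*(\Lambda_n)$ converges in probability as $n\to\infty$, and the generic capacity is $C_g=1/\Delta_g$ (with $1/0=\infty$). Then: 1.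 If $d\le m'$, then $\Delta_g$ exists and $\Delta_g=0$. 2. If $m'\le d\le m+m'$, then $\Delta_g$ exists and $\Delta_g=d-m'$. 3. If $d\ge K(m+m')$, then $\Delta_g$ exists and $\Delta_g=Km$. 4. Suppose $m+m'>0$ and $1<\frac{d}{m+m'}\le K$. (a) If $\Delta_g$ exists, then $$\max\left\{d-m'\left\lceil\frac{d}{m+m'}\right\rceil,\ m\left\lfloor\frac{d}{m+m'}\right\rfloor\right\}\le\Delta_g\le\frac{md}{m+m'}.$$ (b) If $m+m'$ divides $d$, then $\Delta_g$ exists and $\Delta_g=\frac{md}{m+m'}$. (c) One has $\frac{d/(m+m')}{\lfloor d/(m+m')\rfloor}\le 2$, and for $m>0$ this quotient equals $\frac{md/(m+m')}{m\lfloor d/(m+m')\rfloor}$. Consequently, if the generic capacity exists, it is determined within a factor of $2$: $\ \frac{1}{md/(m+m')}\le C_g\le \frac{2}{md/(m+m')}$ (with $1/0=2/0=\infty$). -/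

import Mathlib

open Filter Topology

noncomputable section

namespace LCBC

/-- An instance of the linear computation broadcast problem over `F` with `K` users, data dimension
`d`, demand dimensions `m k` and side-information dimensions `m' k`: the coefficient matrices. -/
structure Instance (F : Type) (K d : ℕ) (m m' : Fin K → ℕ) where
  /-- Coefficients `v_k` of the desired computation of user `k`. -/
  demand : ∀ k, Matrix (Fin d) (Fin (m k)) F
  /-- Coefficients `v'_k` of the side information of user `k`. -/
  side : ∀ k, Matrix (Fin d) (Fin (m' k)) F

instance instFinite (F : Type) [Finite F] (K d : ℕ) (m m' : Fin K → ℕ) :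
    Finite (Instance F K d m m') :=
  Finite.of_injective
    (fun Λ => ((Λ.demand, Λ.side) :
      (∀ k, Matrix (Fin d) (Fin (m k)) F) × (∀ k, Matrix (Fin d) (Fin (m' k)) F)))
    (by rintro ⟨a, b⟩ ⟨a', b'⟩ h; simpa using h)

variable {F : Type} [Field F] {K d : ℕ} {m m' : Fin K → ℕ}

/-- An achievable coding scheme: batch size `L ≥ 1`, a finite alphabet, an (arbitrary) encoder and
(arbitrary) decoders such that every user recovers its demand for every data realization. The
columns of `x` are the `L` data vectors. -/
structure AchievableScheme (Λ : Instance F K d m m') where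
  L : ℕ
  L_pos : 0 < L
  Alphabet : Type
  [fintypeAlphabet : Fintype Alphabet]
  encode : Matrix (Fin d) (Fin L) F → Alphabet
  decode : ∀ k, Alphabet → Matrix (Fin L) (Fin (m' k)) F → Matrix (Fin L) (Fin (m k)) F
  correct : ∀ (x : Matrix (Fin d) (Fin L) F) (k : Fin K),
    decode k (encode x) (x.transpose * Λ.side k) = x.transpose * Λ.demand k

attribute [instance] AchievableScheme.fintypeAlphabet

/-- The normalized broadcast cost `log_q |S| / L`, where `q = |F|`. -/
def AchievableScheme.cost {Λ : Instance F K d m m'} (σ : AchievableScheme Λ) : ℝ :=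
  Real.logb (Nat.card F) (Fintype.card σ.Alphabet) / σ.L

/-- The optimal broadcast cost `Δ*` of an instance. -/
def optimalCost (Λ : Instance F K d m m') : ℝ :=
  ⨅ σ : AchievableScheme Λ, σ.cost

/-- Costs are nonnegative, so the infimum is over a set that is bounded below. -/
theorem AchievableScheme.cost_nonneg [Finite F] {Λ : Instance F K d m m'}
    (σ : AchievableScheme Λ) : 0 ≤ σ.cost := by
  haveI : Nonempty σ.Alphabet := ⟨σ.encode 0⟩
  refine div_nonneg (Real.logb_nonneg ?_ ?_) (Nat.cast_nonneg _)
  · exact_mod_cast Finite.one_lt_card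
  · exact_mod_cast Fintype.card_pos

/-- Broadcasting the data itself is achievable, so the infimum is over a nonempty set. -/
theorem nonempty_achievableScheme [Finite F] (Λ : Instance F K d m m') :
    Nonempty (AchievableScheme Λ) := by
  haveI := Fintype.ofFinite F
  classical
  exact ⟨{ L := 1, L_pos := one_pos, Alphabet := Matrix (Fin d) (Fin 1) F
           encode := id, decode := fun k x _ => x.transpose * Λ.demand k
           correct := fun _ _ => rfl }⟩

end LCBC

/-- The probability that a uniformly random instance over `𝔽_{p^n}` satisfies `P`. -/
def LCBC.prob (p : ℕ) [Fact p.Prime] (n K d : ℕ) (m m' : Fin K → ℕ)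
    (P : LCBC.Instance (GaloisField p n) K d m m' → Prop) : ℝ :=
  (Nat.card {Λ : LCBC.Instance (GaloisField p n) K d m m' // P Λ} : ℝ) /
    (Nat.card (LCBC.Instance (GaloisField p n) K d m m') : ℝ)

/-- `Δg` is the generic optimal broadcast cost (that is, it exists and has this value): the optimal
cost of a uniformly random instance over `𝔽_{p^n}` converges to `Δg` in probability as `n → ∞`. -/
def LCBC.IsGenericCost (p : ℕ) [Fact p.Prime] (K d : ℕ) (m m' : Fin K → ℕ) (Δg : ℝ) : Prop :=
  ∀ ε : ℝ, 0 < ε →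
    Tendsto (fun n : ℕ => LCBC.prob p n K d m m' fun Λ => |LCBC.optimalCost Λ - Δg| < ε)
      atTop (𝓝 1)

/-- `C` is the generic capacity, the reciprocal of the generic optimal broadcast cost
(`∞` if that cost is `0`). -/
def LCBC.IsGenericCapacity (p : ℕ) [Fact p.Prime] (K d : ℕ) (m m' : Fin K → ℕ)
    (C : ENNReal) : Prop :=
  ∃ Δg : ℝ, LCBC.IsGenericCost p K d m m' Δg ∧ C = (ENNReal.ofReal Δg)⁻¹

end

/-!
Lower bounds: the broadcast together with the side information of `t` users determines the values
on the data of all their `t(m + m')` columns, which generically have rank `min d (t(m + m'))`; as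
the side information accounts for only `t m'` symbols, the cost is at least the difference.

If `m' ≤ d`, sending `d - m'` coordinates of the data generically suffices, since every user can
solve for the remaining `m'` coordinates from its side information.

The upper bound `md / (m + m')` comes from interference alignment over the prime field `𝔽_p`, with
`𝔽_q` in the role of an `n`-dimensional space. Let `V ⊆ V'` be the `𝔽_p`-spans of the monomials in
all coefficients with exponents less than `η`, respectively `η + 1`. Multiplication by a coefficient
maps `V` into `V'`, and for suitable `η` both have dimension about `c n`. Fix a nonzero functional
`φ` on `𝔽_q` and broadcast the values of `φ (· * v')` on the `d` data symbols for `v'` in a basis of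
`V'`, at cost about `d c`. Once user `k` has added random combinations `R` of its demand to its side
information, it learns `φ` of all combinations of the columns of `[1 R]` applied to its demand, with
coefficients in `V`. For generic `R` these are about `(m + m') c n` independent constraints on the
`m n` symbols of its demand, and the remaining `(m - (m + m') c) n` are sent separately. The total
cost tends to `d m / (m + m')` as `c` increases to `m / (m + m')`.
-/

namespace LCBC

section UniformProbability

variable {α β ι : Type*}

/-- The probability that a uniformly random element of the finite type `α` lies in `s`. -/
noncomputable def uniformProb (s : Set α) : ℝ :=
  s.ncard / Nat.card α

theorem uniformProb_nonneg (s : Set α) : 0 ≤ uniformProb s := by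
  unfold uniformProb
  positivity

theorem uniformProb_empty : uniformProb (∅ : Set α) = 0 := by
  simp [uniformProb]

theorem uniformProb_mono [Finite α] {s t : Set α} (h : s ⊆ t) : uniformProb s ≤ uniformProb t := by
  unfold uniformProb
  gcongr
  exact t.toFinite

theorem uniformProb_union_le (s t : Set α) :
    uniformProb (s ∪ t) ≤ uniformProb s + uniformProb t := by
  unfold uniformProb
  rw [← add_div]
  gcongr
  exact_mod_cast Set.ncard_union_le s t

theorem uniformProb_compl [Finite α] [Nonempty α] (s : Set α) :
    uniformProb sᶜ = 1 - uniformProb s := by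
  have hα : (Nat.card α : ℝ) ≠ 0 := by exact_mod_cast Nat.card_pos.ne'
  rw [uniformProb, uniformProb, eq_sub_iff_add_eq', ← add_div, div_eq_one_iff_eq hα]
  exact_mod_cast Set.ncard_add_ncard_compl s

theorem uniformProb_iUnion_le_sum [Fintype ι] (s : ι → Set α) :
    uniformProb (⋃ i, s i) ≤ ∑ i, uniformProb (s i) := by
  unfold uniformProb
  rw [← Finset.sum_div]
  gcongr
  exact_mod_cast Set.ncard_iUnion_le_of_fintype s

theorem uniformProb_iUnion_le [Finite ι] (s : ι → Set α) {B : ℝ} (h : ∀ i, uniformProb (s i) ≤ B) :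
    uniformProb (⋃ i, s i) ≤ Nat.card ι * B := by
  have := Fintype.ofFinite ι
  calc uniformProb (⋃ i, s i) ≤ ∑ i, uniformProb (s i) := uniformProb_iUnion_le_sum s
    _ ≤ ∑ _i : ι, B := Finset.sum_le_sum fun i _ => h i
    _ = Nat.card ι * B := by simp

theorem uniformProb_preimage_equiv (e : α ≃ β) (s : Set β) :
    uniformProb (e ⁻¹' s) = uniformProb s := by
  rw [uniformProb, uniformProb, Nat.card_congr e,
    Set.ncard_preimage_of_injective_subset_range e.injective (by simp)]

theorem uniformProb_prod [Finite α] [Finite β] (s : Set (α × β)) :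
    uniformProb s = (∑ᶠ a, uniformProb (Prod.mk a ⁻¹' s)) / Nat.card α := by
  have := Fintype.ofFinite α
  have hs : Nat.card s = ∑ a, Nat.card (Prod.mk a ⁻¹' s) := by
    rw [← Nat.card_sigma]
    exact Nat.card_congr (Equiv.subtypeProdEquivSigmaSubtype fun a b => (a, b) ∈ s)
  simp only [uniformProb, ← Nat.card_coe_set_eq, finsum_eq_sum_of_fintype]
  rw [← Finset.sum_div, div_div, hs, Nat.card_prod]
  push_cast
  ring

theorem uniformProb_prod_le [Finite α] [Nonempty α] [Finite β] (s : Set (α × β)) {B : ℝ}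
    (h : ∀ a, uniformProb (Prod.mk a ⁻¹' s) ≤ B) : uniformProb s ≤ B := by
  have := Fintype.ofFinite α
  have hα : (0 : ℝ) < Nat.card α := by exact_mod_cast Nat.card_pos
  rw [uniformProb_prod, finsum_eq_sum_of_fintype, div_le_iff₀' hα]
  calc ∑ a, uniformProb (Prod.mk a ⁻¹' s) ≤ ∑ _a : α, B := Finset.sum_le_sum fun a _ => h a
    _ = Nat.card α * B := by simp

theorem uniformProb_preimage_fst [Finite β] [Nonempty β] (s : Set α) :
    uniformProb (Prod.fst ⁻¹' s : Set (α × β)) = uniformProb s := by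
  have hβ : (Nat.card β : ℝ) ≠ 0 := by exact_mod_cast Nat.card_pos.ne'
  rw [uniformProb, uniformProb, ← Set.prod_univ, Set.ncard_prod, Set.ncard_univ, Nat.card_prod]
  push_cast
  exact mul_div_mul_right _ _ hβ

theorem card_ker_mul_card_of_surjective {G H : Type*} [AddGroup G] [AddGroup H] {f : G →+ H}
    (hf : Function.Surjective f) : Nat.card f.ker * Nat.card H = Nat.card G := by
  rw [← f.ker.card_mul_index, AddSubgroup.index_ker, AddMonoidHom.range_eq_top_of_surjective f hf,
    AddSubgroup.card_top]

theorem uniformProb_preimage_singleton {G H : Type*} [AddGroup G] [AddGroup H] [Finite G]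
    {f : G →+ H} (hf : Function.Surjective f) (b : H) :
    uniformProb (f ⁻¹' {b}) = (Nat.card H : ℝ)⁻¹ := by
  obtain ⟨a, rfl⟩ := hf b
  have hG : (Nat.card G : ℝ) ≠ 0 := by exact_mod_cast Nat.card_pos.ne'
  have hfiber : f ⁻¹' {f a} = Equiv.addRight (-a) ⁻¹' (f.ker : Set G) := by
    ext x
    simp [AddMonoidHom.mem_ker, add_neg_eq_zero]
  rw [hfiber, uniformProb_preimage_equiv, uniformProb, ← card_ker_mul_card_of_surjective hf] at *
  rw [← Nat.card_coe_set_eq, SetLike.coe_sort_coe]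
  push_cast at hG ⊢
  exact div_mul_cancel_left₀ (left_ne_zero_of_mul hG) _

end UniformProbability

section WithHighProbability

variable {α : ℕ → Type*} [∀ n, Finite (α n)]

/-- The filter of events about a uniformly random element of `α n` that hold with probability
tending to `1` as `n → ∞`. An event is a set of pairs `⟨n, a⟩`; convergence in probability is
convergence along this filter. -/
def whp (α : ℕ → Type*) [∀ n, Finite (α n)] : Filter (Σ n, α n) where
  sets := {s | Tendsto (fun n => uniformProb (Sigma.mk n ⁻¹' sᶜ)) atTop (𝓝 0)}
  univ_sets := by simp [uniformProb_empty]
  sets_of_superset {s t} hs hst :=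
    squeeze_zero (fun n => uniformProb_nonneg _)
      (fun n => uniformProb_mono (Set.preimage_mono (Set.compl_subset_compl.2 hst))) hs
  inter_sets {s t} hs ht :=
    squeeze_zero (g := fun n => uniformProb (Sigma.mk n ⁻¹' sᶜ) + uniformProb (Sigma.mk n ⁻¹' tᶜ))
      (fun n => uniformProb_nonneg _)
      (fun n => by
        rw [Set.compl_inter, Set.preimage_union]
        exact uniformProb_union_le _ _)
      (by simpa only [add_zero] using Tendsto.add hs ht)

theorem eventually_whp_iff_tendsto_zero {P : (Σ n, α n) → Prop} :
    (∀ᶠ x in whp α, P x) ↔ Tendsto (fun n => uniformProb {a | ¬ P ⟨n, a⟩}) atTop (𝓝 0) :=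
  Iff.rfl

theorem eventually_whp_iff_tendsto_one [∀ n, Nonempty (α n)] {P : (Σ n, α n) → Prop} :
    (∀ᶠ x in whp α, P x) ↔ Tendsto (fun n => uniformProb {a | P ⟨n, a⟩}) atTop (𝓝 1) := by
  have hcompl (n : ℕ) : uniformProb {a | ¬ P ⟨n, a⟩} = 1 - uniformProb {a | P ⟨n, a⟩} :=
    uniformProb_compl _
  simp only [eventually_whp_iff_tendsto_zero, hcompl]
  exact ⟨fun h => by simpa using h.const_sub 1, fun h => by simpa using h.const_sub 1⟩

theorem eventually_whp_of_uniformProb_not_le {P : (Σ n, α n) → Prop} {b : ℕ → ℝ}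
    (hb : Tendsto b atTop (𝓝 0)) (h : ∀ᶠ n in atTop, uniformProb {a | ¬ P ⟨n, a⟩} ≤ b n) :
    ∀ᶠ x in whp α, P x :=
  squeeze_zero' (Eventually.of_forall fun _ => uniformProb_nonneg _) h hb

theorem tendsto_fst_whp : Tendsto Sigma.fst (whp α) atTop := by
  refine fun s hs => tendsto_const_nhds.congr' ?_
  filter_upwards [hs] with n hn
  have hfiber : (Sigma.mk n ⁻¹' (Sigma.fst ⁻¹' s)ᶜ : Set (α n)) = ∅ := by
    ext a
    simp [hn]
  rw [hfiber, uniformProb_empty]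

instance whp_neBot [∀ n, Nonempty (α n)] : (whp α).NeBot := by
  refine ⟨fun h => ?_⟩
  have hfalse : ∀ᶠ _x in whp α, False := by simp [h]
  rw [eventually_whp_iff_tendsto_one] at hfalse
  simp only [Set.ofPred_false, uniformProb_empty] at hfalse
  exact zero_ne_one (tendsto_nhds_unique tendsto_const_nhds hfalse)

end WithHighProbability

section SchwartzZippel

open MvPolynomial

variable {σ κ 𝕜 F : Type*} [Field 𝕜] [Field F] [Finite F] [Algebra 𝕜 F]

theorem uniformProb_aeval_eq_zero_le [Finite σ] {P : MvPolynomial σ 𝕜} (hP : P ≠ 0) :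
    uniformProb {w : σ → F | aeval w P = 0} ≤ P.totalDegree / Nat.card F := by
  classical
  have := Fintype.ofFinite F
  obtain ⟨N, ⟨e⟩⟩ := Finite.exists_equiv_fin σ
  set Q : MvPolynomial (Fin N) F := rename e (map (algebraMap 𝕜 F) P)
  have hQ : Q ≠ 0 := by
    rwa [Ne, map_eq_zero_iff _ (rename_injective _ e.injective),
      map_eq_zero_iff _ (map_injective _ (algebraMap 𝕜 F).injective)]
  have hzeros : {w : σ → F | aeval w P = 0} =
      Equiv.arrowCongr e (Equiv.refl F) ⁻¹' {w | eval w Q = 0} := by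
    ext w
    have hw : Equiv.arrowCongr e (Equiv.refl F) w ∘ e = w := by
      ext
      simp
    simp [Q, eval_rename, eval_map, aeval_def, hw]
  have hbound := schwartz_zippel_totalDegree hQ Finset.univ
  have hdegree : Q.totalDegree ≤ P.totalDegree :=
    (totalDegree_rename_le _ _).trans (Finset.sup_mono (support_map_subset _ _))
  rw [hzeros, uniformProb_preimage_equiv]
  calc uniformProb {w | eval w Q = 0} ≤ Q.totalDegree / Nat.card F := by
        rw [uniformProb, Set.ncard_eq_toFinset_card']
        simp only [Fintype.piFinset_univ, Finset.card_univ] at hbound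
        simpa [Set.toFinset_ofPred] using NNRat.cast_mono (K := ℝ) hbound
    _ ≤ P.totalDegree / Nat.card F := by gcongr

theorem uniformProb_not_linearIndependent_aeval_le [Finite σ] [Finite κ] [Finite 𝕜]
    {P : κ → MvPolynomial σ 𝕜} (hP : LinearIndependent 𝕜 P) {D : ℕ}
    (hD : ∀ i, (P i).totalDegree ≤ D) :
    uniformProb {w : σ → F | ¬ LinearIndependent 𝕜 fun i => aeval w (P i)} ≤
      Nat.card (κ → 𝕜) * (D / Nat.card F) := by
  have := Fintype.ofFinite κ
  have hunion : {w : σ → F | ¬ LinearIndependent 𝕜 fun i => aeval w (P i)} ⊆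
      ⋃ c : κ → 𝕜, {w | c ≠ 0 ∧ aeval w (∑ i, c i • P i) = 0} := by
    intro w hw
    obtain ⟨c, hc, i, hi⟩ := Fintype.not_linearIndependent_iff.1 hw
    exact Set.mem_iUnion.2 ⟨c, fun h => hi (congrFun h i), by simpa using hc⟩
  refine (uniformProb_mono hunion).trans (uniformProb_iUnion_le _ fun c => ?_)
  by_cases hc : c = 0
  · simp only [hc, ne_eq, not_true_eq_false, false_and, Set.ofPred_false, uniformProb_empty]
    positivity
  have hne : ∑ i, c i • P i ≠ 0 :=
    fun h => hc (funext (Fintype.linearIndependent_iff.1 hP c h))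
  have hdegree : (∑ i, c i • P i).totalDegree ≤ D :=
    totalDegree_finsetSum_le fun i _ => (totalDegree_smul_le _ _).trans (hD i)
  calc uniformProb {w : σ → F | c ≠ 0 ∧ aeval w (∑ i, c i • P i) = 0}
      ≤ uniformProb {w : σ → F | aeval w (∑ i, c i • P i) = 0} := uniformProb_mono fun w hw => hw.2
    _ ≤ (∑ i, c i • P i).totalDegree / Nat.card F := uniformProb_aeval_eq_zero_le hne
    _ ≤ D / Nat.card F := by gcongr

end SchwartzZippel

section Entries

variable {F : Type} {K d : ℕ} {m m' : Fin K → ℕ}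

/-- The columns of the block matrix `[v₁, v₁', …, v_K, v_K']`: user `k` owns the columns
`⟨k, .inl j⟩` of its demand and `⟨k, .inr j⟩` of its side information. -/
abbrev Column (m m' : Fin K → ℕ) : Type :=
  Σ k, Fin (m k) ⊕ Fin (m' k)

/-- The block matrix `[v₁, v₁', …, v_K, v_K']` of all coefficients of an instance. -/
def Instance.entries (Λ : Instance F K d m m') : Matrix (Fin d) (Column m m') F :=
  .of fun i c => Matrix.fromCols (Λ.demand c.1) (Λ.side c.1) i c.2

theorem Instance.mul_entries_apply [Semiring F] {n : Type*}
    (Λ : Instance F K d m m') (x : Matrix n (Fin d) F) (l : n) (c : Column m m') :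
    (x * Λ.entries) l c = Matrix.fromCols (x * Λ.demand c.1) (x * Λ.side c.1) l c.2 :=
  congrFun (congrFun (Matrix.mul_fromCols x (Λ.demand c.1) (Λ.side c.1)) l) c.2

/-- The identification of instances with points of affine space, through which statements about
zeros of polynomials become statements about random instances. -/
def entriesEquiv : Instance F K d m m' ≃ (Fin d × Column m m' → F) where
  toFun Λ c := Λ.entries c.1 c.2
  invFun w :=
    ⟨fun k => .of fun i j => w (i, ⟨k, .inl j⟩), fun k => .of fun i j => w (i, ⟨k, .inr j⟩)⟩
  left_inv _ := rfl
  right_inv w := by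
    ext ⟨i, k, j | j⟩ <;> rfl

end Entries

section Generic

variable (p : ℕ) [Fact p.Prime] (K d : ℕ) (m m' : Fin K → ℕ)

instance {F : Type} [Zero F] : Nonempty (Instance F K d m m') :=
  ⟨⟨0, 0⟩⟩

/-- The filter of events about a uniformly random instance over `𝔽_{p^n}` whose probability tends
to `1` as `n → ∞`. -/
def generic : Filter (Σ n, Instance (GaloisField p n) K d m m') :=
  whp fun n => Instance (GaloisField p n) K d m m'

instance : (generic p K d m m').NeBot :=
  whp_neBot

variable {p K d m m'}

theorem prob_eq_uniformProb (n : ℕ) (P : Instance (GaloisField p n) K d m m' → Prop) :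
    prob p n K d m m' P = uniformProb {Λ | P Λ} := by
  rw [uniformProb, ← Nat.card_coe_set_eq]
  rfl

theorem isGenericCost_iff_tendsto {Δ : ℝ} :
    IsGenericCost p K d m m' Δ ↔
      Tendsto (fun Λ => optimalCost Λ.2) (generic p K d m m') (𝓝 Δ) := by
  simp only [IsGenericCost, prob_eq_uniformProb, Metric.tendsto_nhds, Real.dist_eq, generic,
    eventually_whp_iff_tendsto_one]

theorem eventually_generic_aeval_ne_zero {P : MvPolynomial (Fin d × Column m m') (ZMod p)}
    (hP : P ≠ 0) :
    ∀ᶠ Λ in generic p K d m m', MvPolynomial.aeval (fun c => Λ.2.entries c.1 c.2) P ≠ 0 := by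
  have hp : 1 < (p : ℝ) := by exact_mod_cast (Fact.out : p.Prime).one_lt
  have hbound : Tendsto (fun n : ℕ => (P.totalDegree : ℝ) / (p : ℝ) ^ n) atTop (𝓝 0) :=
    tendsto_const_nhds.div_atTop (tendsto_pow_atTop_atTop_of_one_lt hp)
  refine eventually_whp_of_uniformProb_not_le hbound ((eventually_ne_atTop 0).mono fun n hn => ?_)
  simp only [not_not]
  calc uniformProb {Λ : Instance (GaloisField p n) K d m m' |
        MvPolynomial.aeval (fun c => Λ.entries c.1 c.2) P = 0}
      = uniformProb {w : Fin d × Column m m' → GaloisField p n | MvPolynomial.aeval w P = 0} :=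
        uniformProb_preimage_equiv entriesEquiv {w | MvPolynomial.aeval w P = 0}
    _ ≤ P.totalDegree / (p : ℝ) ^ n := by
        rw [← Nat.cast_pow, ← GaloisField.card p n hn]
        exact uniformProb_aeval_eq_zero_le hP

theorem eventually_generic_det_submatrix_ne_zero {ι : Type*} [Fintype ι] [DecidableEq ι]
    {ρ : ι → Fin d} (hρ : Function.Injective ρ) {γ : ι → Column m m'}
    (hγ : Function.Injective γ) :
    ∀ᶠ Λ in generic p K d m m', (Λ.2.entries.submatrix ρ γ).det ≠ 0 := by
  set P := MvPolynomial.rename (Prod.map ρ γ) (Matrix.mvPolynomialX ι ι (ZMod p)).det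
  have hP : P ≠ 0 := (map_ne_zero_iff _ (MvPolynomial.rename_injective _ (hρ.prodMap hγ))).2
    (Matrix.det_mvPolynomialX_ne_zero ι (ZMod p))
  refine (eventually_generic_aeval_ne_zero hP).mono fun Λ hΛ => ?_
  rw [MvPolynomial.aeval_rename, AlgHom.map_det] at hΛ
  rwa [← Matrix.mvPolynomialX_mapMatrix_aeval (ZMod p) (Λ.2.entries.submatrix ρ γ)]

end Generic

section Cost

open Matrix

theorem logb_card_pow {F : Type*} [Finite F] [Nontrivial F] (r : ℕ) :
    Real.logb (Nat.card F) ((Nat.card F : ℝ) ^ r) = r := by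
  have hF : 1 < (Nat.card F : ℝ) := by exact_mod_cast Finite.one_lt_card
  rw [Real.logb_pow, Real.logb_self_eq_one hF, mul_one]

variable {F : Type} [Field F] [Finite F] {K d : ℕ} {m m' : Fin K → ℕ}

theorem bddBelow_cost (Λ : Instance F K d m m') :
    BddBelow (Set.range fun σ : AchievableScheme Λ => σ.cost) :=
  ⟨0, by rintro _ ⟨σ, rfl⟩; exact σ.cost_nonneg⟩

theorem optimalCost_nonneg (Λ : Instance F K d m m') : 0 ≤ optimalCost Λ :=
  Real.iInf_nonneg fun σ => σ.cost_nonneg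

theorem optimalCost_le_logb_card_div (Λ : Instance F K d m m') {L : ℕ} (hL : 0 < L)
    {B : Type} [Finite B] (enc : Matrix (Fin d) (Fin L) F → B)
    (h : ∀ k, (fun x : Matrix (Fin d) (Fin L) F => xᵀ * Λ.demand k).FactorsThrough
      fun x => (enc x, xᵀ * Λ.side k)) :
    optimalCost Λ ≤ Real.logb (Nat.card F) (Nat.card B) / L := by
  have := Fintype.ofFinite B
  let σ : AchievableScheme Λ :=
    { L := L
      L_pos := hL
      Alphabet := B
      encode := enc
      decode := fun k s y => Function.extend (fun x => (enc x, xᵀ * Λ.side k))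
        (fun x => xᵀ * Λ.demand k) 0 (s, y)
      correct := fun x k => (h k).extend_apply 0 x }
  refine (ciInf_le (bddBelow_cost Λ) σ).trans_eq ?_
  rw [AchievableScheme.cost, Nat.card_eq_fintype_card (α := B)]

theorem optimalCost_le_logb_card_of_addMonoidHom (Λ : Instance F K d m m') {B : Type}
    [AddGroup B] [Finite B] (enc : (Fin d → F) →+ B)
    (h : ∀ x k, enc x = 0 → x ᵥ* Λ.side k = 0 → x ᵥ* Λ.demand k = 0) :
    optimalCost Λ ≤ Real.logb (Nat.card F) (Nat.card B) := by
  refine (optimalCost_le_logb_card_div Λ one_pos (fun x => enc (xᵀ 0)) fun k x y hxy => ?_).trans_eq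
    (by rw [Nat.cast_one, div_one])
  obtain ⟨henc, hside⟩ := Prod.mk.inj hxy
  ext l j
  obtain rfl := Subsingleton.elim 0 l
  have hdiff := h (xᵀ 0 - yᵀ 0) k (by rw [map_sub, henc, sub_self]) (by
    rw [sub_vecMul, ← mul_apply_eq_vecMul, ← mul_apply_eq_vecMul, hside, sub_self])
  rw [sub_vecMul, sub_eq_zero] at hdiff
  exact congrFun hdiff j

theorem optimalCost_le_sum (Λ : Instance F K d m m') : optimalCost Λ ≤ ∑ k, (m k : ℝ) := by
  let enc : (Fin d → F) →+ ∀ k, Fin (m k) → F :=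
    (LinearMap.pi fun k => (Λ.demand k).vecMulLinear).toAddMonoidHom
  refine (optimalCost_le_logb_card_of_addMonoidHom Λ enc fun x k hx _ => congrFun hx k).trans_eq ?_
  have hcard : Nat.card (∀ k, Fin (m k) → F) = Nat.card F ^ ∑ k, m k := by
    simp [Nat.card_pi, Finset.prod_pow_eq_pow_sum]
  rw [hcard, Nat.cast_pow, logb_card_pow, Nat.cast_sum]

theorem optimalCost_le_card (Λ : Instance F K d m m') (S : Finset (Fin d))
    (h : ∀ k, ∃ γ : {i // i ∉ S} → Fin (m' k),
      ((Λ.side k).submatrix Subtype.val γ).det ≠ 0) :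
    optimalCost Λ ≤ S.card := by
  let enc : (Fin d → F) →+ (S → F) := (LinearMap.funLeft F F Subtype.val).toAddMonoidHom
  refine (optimalCost_le_logb_card_of_addMonoidHom Λ enc fun x k hS hside => ?_).trans_eq ?_
  · have hxS (i : S) : x i = 0 := congrFun hS i
    obtain ⟨γ, hγ⟩ := h k
    have hout : (fun i : {i // i ∉ S} => x i) = 0 := by
      refine eq_zero_of_vecMul_eq_zero hγ (funext fun j => ?_)
      have hj := congrFun hside (γ j)
      rw [vecMul, dotProduct, ← Fintype.sum_subtype_add_sum_subtype (· ∈ S)] at hj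
      simpa [hxS, vecMul, dotProduct] using hj
    have hx : x = 0 := by
      ext i
      by_cases hi : i ∈ S
      · exact hxS ⟨i, hi⟩
      · exact congrFun hout ⟨i, hi⟩
    rw [hx, zero_vecMul]
  · have hcard : Nat.card (S → F) = Nat.card F ^ S.card := by simp [Nat.card_fun]
    rw [hcard, Nat.cast_pow, logb_card_pow]

theorem AchievableScheme.card_pow_le {ι : Type*} [Fintype ι] [DecidableEq ι]
    {Λ : Instance F K d m m'} (σ : AchievableScheme Λ) (T : Finset (Fin K)) {ρ : ι → Fin d}
    {γ : ι → Column m m'} (hγ : ∀ i, (γ i).1 ∈ T) (hdet : (Λ.entries.submatrix ρ γ).det ≠ 0) :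
    Nat.card F ^ (Fintype.card ι * σ.L) ≤
      Fintype.card σ.Alphabet * Nat.card F ^ ((∑ k ∈ T, m' k) * σ.L) := by
  have := Fintype.ofFinite F
  let E : Matrix (Fin d) ι F := (1 : Matrix (Fin d) (Fin d) F).submatrix id ρ
  have hE (z : Matrix ι (Fin σ.L) F) (l : Fin σ.L) (j : ι) :
      (zᵀ * Λ.entries.submatrix ρ γ) l j = ((E * z)ᵀ * Λ.entries) l (γ j) := by
    have hsub : Eᵀ * Λ.entries = Λ.entries.submatrix ρ id := by
      ext i c
      simp [E, mul_apply, one_apply]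
    rw [transpose_mul, Matrix.mul_assoc, hsub]
    rfl
  let f : Matrix ι (Fin σ.L) F → σ.Alphabet × (∀ k : T, Matrix (Fin σ.L) (Fin (m' k)) F) :=
    fun z => (σ.encode (E * z), fun k => (E * z)ᵀ * Λ.side k)
  have hf : Function.Injective f := by
    intro y z hyz
    obtain ⟨henc, hsides⟩ := Prod.mk.inj hyz
    have hside (k) (hk : k ∈ T) : (E * y)ᵀ * Λ.side k = (E * z)ᵀ * Λ.side k :=
      congrFun hsides ⟨k, hk⟩
    have hdemand (k) (hk : k ∈ T) : (E * y)ᵀ * Λ.demand k = (E * z)ᵀ * Λ.demand k := by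
      rw [← σ.correct, ← σ.correct, henc, hside k hk]
    have hmul : yᵀ * Λ.entries.submatrix ρ γ = zᵀ * Λ.entries.submatrix ρ γ := by
      ext l j
      rw [hE, hE, Λ.mul_entries_apply, Λ.mul_entries_apply, hside _ (hγ j), hdemand _ (hγ j)]
    have := invertibleOfIsUnitDet _ hdet.isUnit
    exact transpose_injective (mul_left_injective_of_invertible _ hmul)
  have hcard := Nat.card_le_card_of_injective f hf
  have hsum : ∑ k : T, m' k = ∑ k ∈ T, m' k := Finset.sum_coe_sort T m'
  simpa [Matrix, Nat.card_pi, ← pow_mul, Finset.prod_pow_eq_pow_sum, mul_comm, ← hsum,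
    Finset.mul_sum] using hcard

theorem sub_sum_le_optimalCost {ι : Type*} [Fintype ι] [DecidableEq ι] (Λ : Instance F K d m m')
    (T : Finset (Fin K)) {ρ : ι → Fin d} {γ : ι → Column m m'} (hγ : ∀ i, (γ i).1 ∈ T)
    (hdet : (Λ.entries.submatrix ρ γ).det ≠ 0) :
    (Fintype.card ι : ℝ) - ∑ k ∈ T, (m' k : ℝ) ≤ optimalCost Λ := by
  have := nonempty_achievableScheme Λ
  refine le_ciInf fun σ => ?_
  have : Nonempty σ.Alphabet := ⟨σ.encode 0⟩
  have hL : (0 : ℝ) < σ.L := by exact_mod_cast σ.L_pos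
  have hF : 1 < (Nat.card F : ℝ) := by exact_mod_cast Finite.one_lt_card
  have hS : (0 : ℝ) < Fintype.card σ.Alphabet := by exact_mod_cast Fintype.card_pos
  have hcard : (Nat.card F : ℝ) ^ (Fintype.card ι * σ.L) ≤
      Fintype.card σ.Alphabet * (Nat.card F : ℝ) ^ ((∑ k ∈ T, m' k) * σ.L) := by
    exact_mod_cast σ.card_pow_le T hγ hdet
  have hlog := Real.logb_le_logb_of_le hF (by positivity) hcard
  rw [Real.logb_mul hS.ne' (by positivity), logb_card_pow, logb_card_pow] at hlog
  push_cast at hlog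
  rw [AchievableScheme.cost, le_div_iff₀ hL]
  linarith

end Cost

section GenericCost

variable {p : ℕ} [Fact p.Prime] {K d : ℕ} {m m' : Fin K → ℕ}

theorem eventually_generic_optimalCost_le_sub {a : ℕ} (h : ∀ k, a ≤ m' k) :
    ∀ᶠ Λ in generic p K d m m', optimalCost Λ.2 ≤ (d - a : ℕ) := by
  obtain ⟨S, -, hS⟩ := Finset.exists_subset_card_eq (s := (Finset.univ : Finset (Fin d)))
    (n := d - a) (by simp)
  have hcols (k) : Nonempty ({i // i ∉ S} ↪ Fin (m' k)) :=
    Function.Embedding.nonempty_of_card_le (by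
      rw [Fintype.card_subtype_compl]
      simp only [Fintype.card_fin, Fintype.card_coe, hS]
      exact (by lia : d - (d - a) ≤ a).trans (h k))
  let γ (k) : {i // i ∉ S} ↪ Fin (m' k) := (hcols k).some
  have hminor (k) : ∀ᶠ Λ in generic p K d m m',
      ((Λ.2.side k).submatrix Subtype.val (γ k)).det ≠ 0 :=
    eventually_generic_det_submatrix_ne_zero (γ := fun j => (⟨k, .inr (γ k j)⟩ : Column m m'))
      Subtype.val_injective
      (sigma_mk_injective.comp (Sum.inr_injective.comp (γ k).injective))
  filter_upwards [eventually_all.2 hminor] with Λ hΛ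
  rw [← hS]
  exact optimalCost_le_card Λ.2 S fun k => ⟨γ k, hΛ k⟩

theorem eventually_generic_min_sub_le_optimalCost (T : Finset (Fin K)) :
    ∀ᶠ Λ in generic p K d m m',
      min (d : ℝ) (∑ k ∈ T, ((m k : ℝ) + m' k)) - ∑ k ∈ T, (m' k : ℝ) ≤ optimalCost Λ.2 := by
  set r := min d (∑ k ∈ T, (m k + m' k))
  let C : Finset (Column m m') := T.sigma fun _ => Finset.univ
  obtain ⟨γ⟩ : Nonempty (Fin r ↪ C) := Function.Embedding.nonempty_of_card_le (by
    rw [Fintype.card_coe, Finset.card_sigma]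
    simp [r])
  have hminor := eventually_generic_det_submatrix_ne_zero (p := p) (m := m) (m' := m')
    (Fin.castLE_injective (min_le_left d _)) (Subtype.val_injective.comp γ.injective)
  filter_upwards [hminor] with Λ hΛ
  have hcost := sub_sum_le_optimalCost Λ.2 T (fun i => (Finset.mem_sigma.1 (γ i).2).1) hΛ
  simpa [r] using hcost

end GenericCost

section ColumnsIndependentOver

open Matrix

variable {𝕜 F ι κ : Type*} [Field 𝕜] [Field F] [Algebra 𝕜 F] [Fintype κ] {V : Submodule 𝕜 F}
  {M : Matrix ι κ F}

/-- No nontrivial linear relation between the columns of `M` has all its coefficients in the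
`𝕜`-subspace `V`. -/
def ColumnsIndependentOver (V : Submodule 𝕜 F) (M : Matrix ι κ F) : Prop :=
  ∀ c : κ → V, M *ᵥ (fun j => (c j : F)) = 0 → c = 0

/-- The pairing `(y, c) ↦ φ (y ⬝ᵥ M *ᵥ c)` of vectors `y` over `F` with vectors `c` over the
`𝕜`-subspace `V`, for a functional `φ` that plays the part of the trace form. -/
def functionalPairing [Fintype ι] (φ : Module.Dual 𝕜 F) (V : Submodule 𝕜 F) (M : Matrix ι κ F) :
    (ι → F) →ₗ[𝕜] Module.Dual 𝕜 (κ → V) :=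
  ((dotProductBilin 𝕜 𝕜).compl₂
    (M.mulVecLin.restrictScalars 𝕜 ∘ₗ V.subtype.compLeft κ)).compr₂ φ

theorem functionalPairing_apply [Fintype ι] (φ : Module.Dual 𝕜 F) (y : ι → F) (c : κ → V) :
    functionalPairing φ V M y c = φ (y ⬝ᵥ M *ᵥ fun j => (c j : F)) :=
  rfl

theorem eq_zero_of_forall_dotProduct [Fintype ι] {φ : Module.Dual 𝕜 F} (hφ : φ ≠ 0) {u : ι → F}
    (h : ∀ y, φ (y ⬝ᵥ u) = 0) : u = 0 := by
  classical
  ext i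
  by_contra hi
  refine hφ (LinearMap.ext fun t => ?_)
  simpa [inv_mul_cancel_right₀ hi] using h (Pi.single i (t * (u i)⁻¹))

variable [Fintype ι] [Finite F] {φ : Module.Dual 𝕜 F}

theorem functionalPairing_surjective (hφ : φ ≠ 0) (hM : ColumnsIndependentOver V M) :
    Function.Surjective (functionalPairing φ V M) := by
  have := Module.Finite.of_finite (R := 𝕜) (M := ι → F)
  rw [← LinearMap.flip_injective_iff₁, ← LinearMap.ker_eq_bot, LinearMap.ker_eq_bot']
  exact fun c hc => hM c (eq_zero_of_forall_dotProduct hφ fun y => LinearMap.congr_fun hc y)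

theorem card_dual {W : Type*} [AddCommGroup W] [Module 𝕜 W] [Finite W] :
    Nat.card (Module.Dual 𝕜 W) = Nat.card W := by
  have := Module.Finite.of_finite (R := 𝕜) (M := W)
  rw [Module.natCard_eq_pow_finrank (K := 𝕜), Module.natCard_eq_pow_finrank (K := 𝕜) (V := W),
    Subspace.dual_finrank_eq]

theorem logb_card_ker_functionalPairing (hφ : φ ≠ 0) (hM : ColumnsIndependentOver V M) :
    Real.logb (Nat.card F) (Nat.card (functionalPairing φ V M).ker) =
      Fintype.card ι - Fintype.card κ * Real.logb (Nat.card F) (Nat.card V) := by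
  set T := functionalPairing φ V M
  have hcard : (Nat.card T.ker : ℝ) * (Nat.card V : ℝ) ^ Fintype.card κ =
      (Nat.card F : ℝ) ^ Fintype.card ι := by
    have h := card_ker_mul_card_of_surjective (f := T.toAddMonoidHom)
      (functionalPairing_surjective hφ hM)
    rw [card_dual, Nat.card_fun, Nat.card_fun, Nat.card_eq_fintype_card (α := ι),
      Nat.card_eq_fintype_card (α := κ)] at h
    exact_mod_cast h
  have hker : (0 : ℝ) < Nat.card T.ker := by exact_mod_cast Nat.card_pos
  have hV : (0 : ℝ) < Nat.card V := by exact_mod_cast Nat.card_pos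
  have hlog := congrArg (Real.logb (Nat.card F)) hcard
  rw [Real.logb_mul hker.ne' (by positivity), Real.logb_pow, logb_card_pow] at hlog
  linarith

end ColumnsIndependentOver

section Alignment

open Matrix

variable {𝕜 F : Type} [Field 𝕜] [Field F] [Algebra 𝕜 F] {K d : ℕ} {m m' : Fin K → ℕ}

/-- The instance in which combinations of the demand of each user, given by the columns of `R k`,
are added to its side information. -/
def Instance.shear (Λ : Instance F K d m m') (R : ∀ k, Matrix (Fin (m k)) (Fin (m' k)) F) :
    Instance F K d m m' :=
  ⟨Λ.demand, fun k => Λ.side k + Λ.demand k * R k⟩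

/-- The matrix `[1 R]`, a generator matrix in systematic form. -/
abbrev systematic {μ ν F : Type*} [DecidableEq μ] [Zero F] [One F] (R : Matrix μ ν F) :
    Matrix μ (μ ⊕ ν) F :=
  fromCols 1 R

theorem Instance.vecMul_demand_vecMul_systematic (Λ : Instance F K d m m')
    (R : ∀ k, Matrix (Fin (m k)) (Fin (m' k)) F) {x : Fin d → F} {k : Fin K}
    (hx : x ᵥ* Λ.side k = 0) :
    (x ᵥ* Λ.demand k) ᵥ* systematic (R k) =
      x ᵥ* (Λ.shear R).entries.submatrix id (Sigma.mk k) := by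
  have hentries : (Λ.shear R).entries.submatrix id (Sigma.mk k) =
      fromCols (Λ.demand k) (Λ.side k + Λ.demand k * R k) := rfl
  rw [hentries, vecMul_fromCols, vecMul_fromCols, vecMul_add, hx, zero_add, vecMul_one,
    vecMul_vecMul]

theorem functionalPairing_vecMul_demand_eq_zero {Λ : Instance F K d m m'}
    {R : ∀ k, Matrix (Fin (m k)) (Fin (m' k)) F} {φ : Module.Dual 𝕜 F} {V V' : Submodule 𝕜 F}
    (hV : ∀ i c, ∀ v ∈ V, (Λ.shear R).entries i c * v ∈ V') {x : Fin d → F} {k : Fin K}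
    (hx : functionalPairing φ V' (1 : Matrix (Fin d) (Fin d) F) x = 0)
    (hside : x ᵥ* Λ.side k = 0) :
    functionalPairing φ V (systematic (R k)) (x ᵥ* Λ.demand k) = 0 := by
  refine LinearMap.ext fun c => ?_
  set u := (Λ.shear R).entries.submatrix id (Sigma.mk k) *ᵥ fun j => (c j : F)
  have hu (i) : u i ∈ V' := V'.sum_mem (t := Finset.univ) fun j _ => hV i ⟨k, j⟩ (c j) (c j).2
  have hpair := LinearMap.congr_fun hx fun i => ⟨u i, hu i⟩
  rw [functionalPairing_apply, one_mulVec] at hpair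
  rwa [functionalPairing_apply, dotProduct_mulVec, Λ.vecMul_demand_vecMul_systematic R hside,
    ← dotProduct_mulVec]

theorem optimalCost_le_of_columnsIndependentOver [Finite F] (Λ : Instance F K d m m')
    (R : ∀ k, Matrix (Fin (m k)) (Fin (m' k)) F) {V V' : Submodule 𝕜 F}
    (hV : ∀ i c, ∀ v ∈ V, (Λ.shear R).entries i c * v ∈ V')
    (hR : ∀ k, ColumnsIndependentOver V (systematic (R k))) :
    optimalCost Λ ≤ d * Real.logb (Nat.card F) (Nat.card V') +
      ∑ k, (m k - (m k + m' k) * Real.logb (Nat.card F) (Nat.card V)) := by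
  have : Finite 𝕜 := Finite.of_injective _ (algebraMap 𝕜 F).injective
  have : Finite (Module.Dual 𝕜 (Fin d → V')) := DFunLike.finite _
  obtain ⟨φ, hφ⟩ : ∃ φ : Module.Dual 𝕜 F, φ ≠ 0 := exists_ne 0
  let T (k) := functionalPairing φ V (systematic (R k))
  choose π hπ using fun k => LinearMap.exists_leftInverse_of_injective (T k).ker.subtype
    (Submodule.ker_subtype _)
  let enc : (Fin d → F) →ₗ[𝕜] Module.Dual 𝕜 (Fin d → V') × ∀ k, (T k).ker :=
    (functionalPairing φ V' 1).prod
      (LinearMap.pi fun k => π k ∘ₗ (Λ.demand k).vecMulLinear.restrictScalars 𝕜)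
  refine (optimalCost_le_logb_card_of_addMonoidHom Λ enc.toAddMonoidHom
    fun x k hx hside => ?_).trans_eq ?_
  · obtain ⟨hpair, hproj⟩ := Prod.mk.inj hx
    have hker : x ᵥ* Λ.demand k ∈ (T k).ker :=
      functionalPairing_vecMul_demand_eq_zero hV hpair hside
    have hid := LinearMap.congr_fun (hπ k) ⟨_, hker⟩
    exact congrArg Subtype.val (hid.symm.trans (congrFun hproj k))
  · have hV' : (Nat.card V' : ℝ) ≠ 0 := by exact_mod_cast Nat.card_pos.ne'
    have hT (k) : (Nat.card (T k).ker : ℝ) ≠ 0 := by exact_mod_cast Nat.card_pos.ne'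
    have hlogT (k) : Real.logb (Nat.card F) (Nat.card (T k).ker) =
        m k - (m k + m' k) * Real.logb (Nat.card F) (Nat.card V) := by
      simpa using logb_card_ker_functionalPairing hφ (hR k)
    rw [Nat.card_prod, card_dual, Nat.card_fun, Nat.card_pi, Nat.card_fin, Nat.cast_mul,
      Nat.cast_prod, Nat.cast_pow, Real.logb_mul (pow_ne_zero d hV')
        (Finset.prod_ne_zero_iff.2 fun k _ => hT k), Real.logb_pow,
      Real.logb_prod _ _ fun k _ => hT k]
    simp only [hlogT]

end Alignment

section BoxMonomial

open MvPolynomial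

variable {σ 𝕜 F : Type*} [Fintype σ] [Field 𝕜] [Field F] [Algebra 𝕜 F] {η : ℕ}

/-- The monomial with exponents `e`, all less than `η`. -/
noncomputable def boxMonomial (𝕜 : Type*) [Field 𝕜] (e : σ → Fin η) : MvPolynomial σ 𝕜 :=
  monomial (Finsupp.equivFunOnFinite.symm fun s => (e s : ℕ)) 1

theorem aeval_boxMonomial (w : σ → F) (e : σ → Fin η) :
    aeval w (boxMonomial 𝕜 e) = ∏ s, w s ^ (e s : ℕ) := by
  simp [boxMonomial, aeval_monomial, Finsupp.prod_fintype]

theorem linearIndependent_boxMonomial :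
    LinearIndependent 𝕜 (boxMonomial 𝕜 : (σ → Fin η) → MvPolynomial σ 𝕜) := by
  have h := (basisMonomials σ 𝕜).linearIndependent.comp
    (fun e : σ → Fin η => Finsupp.equivFunOnFinite.symm fun s => (e s : ℕ))
    (Finsupp.equivFunOnFinite.symm.injective.comp Fin.val_injective.comp_left)
  rwa [coe_basisMonomials] at h

theorem totalDegree_boxMonomial_le (e : σ → Fin η) :
    (boxMonomial 𝕜 e).totalDegree ≤ Fintype.card σ * η := by
  rw [boxMonomial, totalDegree_monomial _ one_ne_zero,
    Finsupp.sum_fintype _ _ fun _ => rfl]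
  simpa using Finset.sum_le_card_nsmul Finset.univ (fun s => (e s : ℕ)) η fun s _ => (e s).2.le

/-- The `𝕜`-span of the values at `w` of the monomials all of whose exponents are less than `η`; for
large `η`, a space that is almost stable under multiplication by the entries of `w`. -/
noncomputable def boxSpan (𝕜 : Type*) [Field 𝕜] [Algebra 𝕜 F] (w : σ → F) (η : ℕ) :
    Submodule 𝕜 F :=
  Submodule.span 𝕜 (Set.range fun e : σ → Fin η => aeval w (boxMonomial 𝕜 e))

theorem mul_mem_boxSpan {w : σ → F} (s : σ) {v : F} (hv : v ∈ boxSpan 𝕜 w η) :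
    w s * v ∈ boxSpan 𝕜 w (η + 1) := by
  classical
  suffices boxSpan 𝕜 w η ≤ (boxSpan 𝕜 w (η + 1)).comap (LinearMap.mulLeft 𝕜 (w s)) from this hv
  refine Submodule.span_le.2 ?_
  rintro _ ⟨e, rfl⟩
  refine Submodule.subset_span ⟨fun t => if t = s then (e t).succ else (e t).castSucc, ?_⟩
  simp only [aeval_boxMonomial, LinearMap.mulLeft_apply]
  rw [← Finset.mul_prod_erase _ _ (Finset.mem_univ s),
    ← Finset.mul_prod_erase _ (fun t => w t ^ (e t : ℕ)) (Finset.mem_univ s), ← mul_assoc]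
  congr 1
  · simp [pow_succ']
  · refine Finset.prod_congr rfl fun t ht => ?_
    simp [Finset.ne_of_mem_erase ht]

theorem finrank_boxSpan_le (w : σ → F) :
    Module.finrank 𝕜 (boxSpan 𝕜 w η) ≤ η ^ Fintype.card σ := by
  classical
  refine (finrank_range_le_card fun e : σ → Fin η => aeval w (boxMonomial 𝕜 e)).trans_eq ?_
  rw [Fintype.card_fun, Fintype.card_fin]

theorem finrank_boxSpan {w : σ → F}
    (h : LinearIndependent 𝕜 fun e : σ → Fin η => aeval w (boxMonomial 𝕜 e)) :
    Module.finrank 𝕜 (boxSpan 𝕜 w η) = η ^ Fintype.card σ := by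
  classical
  rw [boxSpan, finrank_span_eq_card h, Fintype.card_fun, Fintype.card_fin]

theorem card_boxSpan_le [Finite 𝕜] [Finite F] (w : σ → F) :
    Nat.card (boxSpan 𝕜 w η) ≤ Nat.card 𝕜 ^ η ^ Fintype.card σ := by
  rw [Module.natCard_eq_pow_finrank (K := 𝕜)]
  exact Nat.pow_le_pow_right Nat.card_pos (finrank_boxSpan_le w)

theorem card_boxSpan [Finite F] {w : σ → F}
    (h : LinearIndependent 𝕜 fun e : σ → Fin η => aeval w (boxMonomial 𝕜 e)) :
    Nat.card (boxSpan 𝕜 w η) = Nat.card 𝕜 ^ η ^ Fintype.card σ := by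
  rw [Module.natCard_eq_pow_finrank (K := 𝕜), finrank_boxSpan h]

end BoxMonomial

section RandomCombinations

open Matrix

theorem mulVec_right_surjective {μ ν F : Type*} [Fintype ν] [Field F] {g : ν → F} (hg : g ≠ 0) :
    Function.Surjective fun R : Matrix μ ν F => R *ᵥ g := by
  classical
  obtain ⟨j, hj⟩ := Function.ne_iff.1 hg
  refine fun y => ⟨vecMulVec y (Pi.single j (g j)⁻¹), ?_⟩
  simp [vecMulVec_mulVec, inv_mul_cancel₀ hj]

variable {ι 𝕜 F : Type*} [Finite ι] {μ ν : ι → Type*} [∀ i, Fintype (μ i)] [∀ i, Fintype (ν i)]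
  [∀ i, DecidableEq (μ i)] [Field F] [Finite F]

theorem uniformProb_systematic_mulVec_eq_zero_le (i : ι) {c : μ i ⊕ ν i → F} (hc : c ≠ 0) :
    uniformProb {R : ∀ i, Matrix (μ i) (ν i) F | systematic (R i) *ᵥ c = 0} ≤
      ((Nat.card F : ℝ) ^ Fintype.card (μ i))⁻¹ := by
  have hmul (R : Matrix (μ i) (ν i) F) :
      systematic R *ᵥ c = c ∘ Sum.inl + R *ᵥ (c ∘ Sum.inr) := by
    rw [systematic, fromCols_mulVec, one_mulVec]
  by_cases hright : c ∘ Sum.inr = 0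
  · have hempty : {R : ∀ i, Matrix (μ i) (ν i) F | systematic (R i) *ᵥ c = 0} = ∅ := by
      refine Set.eq_empty_of_forall_notMem fun R (hR : systematic (R i) *ᵥ c = 0) => hc ?_
      rw [hmul, hright, mulVec_zero, add_zero] at hR
      ext (j | j)
      · exact congrFun hR j
      · exact congrFun hright j
    rw [hempty, uniformProb_empty]
    positivity
  · let f : (∀ i, Matrix (μ i) (ν i) F) →+ (μ i → F) :=
      { toFun := fun R => R i *ᵥ (c ∘ Sum.inr)
        map_zero' := zero_mulVec _
        map_add' := fun R S => add_mulVec (R i) (S i) _ }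
    have hf : Function.Surjective f :=
      (mulVec_right_surjective hright).comp (Function.surjective_eval i)
    have hfiber : {R : ∀ i, Matrix (μ i) (ν i) F | systematic (R i) *ᵥ c = 0} =
        f ⁻¹' {-(c ∘ Sum.inl)} := by
      ext R
      simp [hmul, f, eq_neg_iff_add_eq_zero, add_comm]
    rw [hfiber, uniformProb_preimage_singleton hf]
    simp [Nat.card_fun]

theorem uniformProb_not_columnsIndependentOver_systematic_le [Field 𝕜] [Algebra 𝕜 F]
    (V : Submodule 𝕜 F) (i : ι) :
    uniformProb {R : ∀ i, Matrix (μ i) (ν i) F | ¬ ColumnsIndependentOver V (systematic (R i))} ≤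
      (Nat.card V : ℝ) ^ Fintype.card (μ i ⊕ ν i) *
        ((Nat.card F : ℝ) ^ Fintype.card (μ i))⁻¹ := by
  have hunion : {R : ∀ i, Matrix (μ i) (ν i) F | ¬ ColumnsIndependentOver V (systematic (R i))} ⊆
      ⋃ c : {c : μ i ⊕ ν i → V // c ≠ 0}, {R | systematic (R i) *ᵥ (fun j => (c.1 j : F)) = 0} := by
    intro R hR
    obtain ⟨c, hc, hne⟩ : ∃ c : μ i ⊕ ν i → V, systematic (R i) *ᵥ (fun j => (c j : F)) = 0 ∧
        c ≠ 0 := by simpa [ColumnsIndependentOver] using hR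
    exact Set.mem_iUnion.2 ⟨⟨c, hne⟩, hc⟩
  have hne (c : {c : μ i ⊕ ν i → V // c ≠ 0}) : (fun j => (c.1 j : F)) ≠ 0 := fun h =>
    c.2 (funext fun j => Subtype.ext (congrFun h j))
  have hcard : (Nat.card {c : μ i ⊕ ν i → V // c ≠ 0} : ℝ) ≤
      (Nat.card V : ℝ) ^ Fintype.card (μ i ⊕ ν i) := by
    rw [← Nat.cast_pow, ← Nat.card_eq_fintype_card, ← Nat.card_fun]
    exact_mod_cast Finite.card_subtype_le _
  calc _ ≤ Nat.card {c : μ i ⊕ ν i → V // c ≠ 0} * ((Nat.card F : ℝ) ^ Fintype.card (μ i))⁻¹ :=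
        (uniformProb_mono hunion).trans
          (uniformProb_iUnion_le _ fun c => uniformProb_systematic_mulVec_eq_zero_le i (hne c))
    _ ≤ _ := by gcongr

end RandomCombinations

section Asymptotics

theorem exists_natCast_pow_div_tendsto {c : ℝ} (hc : 0 < c) {W : ℕ} (hW : W ≠ 0) :
    ∃ η : ℕ → ℕ, Tendsto (fun n => (η n : ℝ) ^ W / n) atTop (𝓝 c) ∧
      Tendsto (fun n => (η n + 1 : ℝ) ^ W / n) atTop (𝓝 c) := by
  have hroot : Tendsto (fun n : ℕ => (c * n) ^ (W : ℝ)⁻¹) atTop atTop :=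
    (tendsto_rpow_atTop (by positivity)).comp (tendsto_natCast_atTop_atTop.const_mul_atTop hc)
  have hfloor (a : ℝ) :
      Tendsto (fun n : ℕ => (⌊(c * n) ^ (W : ℝ)⁻¹⌋₊ + a) ^ W / n) atTop (𝓝 c) := by
    have hratio : Tendsto (fun n : ℕ => (⌊(c * n) ^ (W : ℝ)⁻¹⌋₊ + a) / (c * n) ^ (W : ℝ)⁻¹)
        atTop (𝓝 1) := by
      simpa [add_div] using
        ((tendsto_nat_floor_div_atTop (R := ℝ)).comp hroot).add (hroot.const_div_atTop a)
    refine (by simpa using (hratio.pow W).const_mul c : Tendsto _ _ (𝓝 c)).congr' ?_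
    filter_upwards [eventually_ne_atTop 0] with n hn
    rw [div_pow, Real.rpow_inv_natCast_pow (by positivity) hW]
    field_simp
  exact ⟨fun n => ⌊(c * n) ^ (W : ℝ)⁻¹⌋₊, by simpa using hfloor 0, hfloor 1⟩

theorem tendsto_mul_pow_mul_inv_pow_pow {x : ℝ} (hx : 1 < x) {a : ℕ → ℕ} {b : ℕ} {c : ℝ}
    (ha : Tendsto (fun n => (a n : ℝ) / n) atTop (𝓝 c)) (hc : c < b) :
    Tendsto (fun n : ℕ => n * (x ^ a n * ((x ^ n) ^ b)⁻¹)) atTop (𝓝 0) := by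
  obtain ⟨r, hcr, hrb⟩ := exists_between hc
  have hx0 : 0 < x := by linarith
  have hgeom := tendsto_self_mul_const_pow_of_lt_one (r := x ^ (r - b)) (by positivity)
    (Real.rpow_lt_one_of_one_lt_of_neg hx (by linarith))
  refine squeeze_zero' (Eventually.of_forall fun n => by positivity) ?_ hgeom
  filter_upwards [ha.eventually_le_const hcr, eventually_gt_atTop 0] with n hn hn0
  rw [div_le_iff₀ (by positivity)] at hn
  gcongr
  calc x ^ a n * ((x ^ n) ^ b)⁻¹ = x ^ (a n - b * n : ℝ) := by
        rw [Real.rpow_sub hx0, ← Nat.cast_mul, Real.rpow_natCast, Real.rpow_natCast, ← pow_mul,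
          mul_comm n, div_eq_mul_inv]
    _ ≤ x ^ ((r - b) * n) := Real.rpow_le_rpow_of_exponent_le hx.le (by linarith)
    _ = (x ^ (r - b)) ^ n := by rw [Real.rpow_mul hx0.le, Real.rpow_natCast]

theorem logb_card_galoisField_pow (p : ℕ) [Fact p.Prime] {n : ℕ} (hn : n ≠ 0) (a : ℕ) :
    Real.logb (Nat.card (GaloisField p n)) ((p : ℝ) ^ a) = a / n := by
  have hp : Real.log p ≠ 0 :=
    (Real.log_pos (by exact_mod_cast (Fact.out : p.Prime).one_lt)).ne'
  rw [GaloisField.card p n hn, Nat.cast_pow, Real.logb, Real.log_pow, Real.log_pow]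
  field_simp

end Asymptotics

section GenericAlignment

open Matrix MvPolynomial

variable {p : ℕ} [Fact p.Prime] {K d : ℕ} {m m' : Fin K → ℕ}

/-- Shearing an instance by given matrices is invertible, so a random shear of a uniformly random
instance is uniformly random. -/
def shearEquiv {F : Type} [Field F] :
    Instance F K d m m' × (∀ k, Matrix (Fin (m k)) (Fin (m' k)) F) ≃
      Instance F K d m m' × (∀ k, Matrix (Fin (m k)) (Fin (m' k)) F) where
  toFun x := (x.1.shear x.2, x.2)
  invFun x := (x.1.shear (-x.2), x.2)
  left_inv x := by simp [Instance.shear]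
  right_inv x := by simp [Instance.shear]

/-- The values of the monomials with exponents less than `η` at the coefficients of `Λ` are linearly
independent, and no user `k` has a relation between the columns of `[1 R k]` whose coefficients lie
in the span of those values: the condition under which interference alignment succeeds. -/
def BoxIndependent {F : Type} (𝕜 : Type*) [Field 𝕜] [Field F] [Algebra 𝕜 F] (η : ℕ)
    (Λ : Instance F K d m m') (R : ∀ k, Matrix (Fin (m k)) (Fin (m' k)) F) : Prop :=
  (LinearIndependent 𝕜 fun e : Fin d × Column m m' → Fin η =>
    aeval (entriesEquiv Λ) (boxMonomial 𝕜 e)) ∧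
  ∀ k, ColumnsIndependentOver (boxSpan 𝕜 (entriesEquiv Λ) η) (systematic (R k))

theorem uniformProb_not_linearIndependent_boxMonomial_le {𝕜 F : Type} [Field 𝕜] [Finite 𝕜]
    [Field F] [Finite F] [Algebra 𝕜 F] (η : ℕ) :
    uniformProb {Λ : Instance F K d m m' |
        ¬ LinearIndependent 𝕜 fun e : Fin d × Column m m' → Fin η =>
          aeval (entriesEquiv Λ) (boxMonomial 𝕜 e)} ≤
      (Nat.card 𝕜 : ℝ) ^ η ^ Fintype.card (Fin d × Column m m') *
        (Fintype.card (Fin d × Column m m') * η / Nat.card F) :=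
  calc _ = uniformProb {w : Fin d × Column m m' → F |
          ¬ LinearIndependent 𝕜 fun e : Fin d × Column m m' → Fin η =>
            aeval w (boxMonomial 𝕜 e)} := uniformProb_preimage_equiv entriesEquiv _
    _ ≤ Nat.card ((Fin d × Column m m' → Fin η) → 𝕜) *
          ((Fintype.card (Fin d × Column m m') * η : ℕ) / Nat.card F) :=
        uniformProb_not_linearIndependent_aeval_le linearIndependent_boxMonomial
          totalDegree_boxMonomial_le
    _ = _ := by
        rw [Nat.card_fun, Nat.card_fun, Nat.card_fin, Nat.card_eq_fintype_card (α := Fin d × _)]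
        push_cast
        rfl

theorem uniformProb_not_columnsIndependentOver_boxSpan_le {𝕜 F : Type} [Field 𝕜] [Finite 𝕜]
    [Field F] [Finite F] [Algebra 𝕜 F] (η : ℕ) (k : Fin K) :
    uniformProb {x : Instance F K d m m' × ∀ k, Matrix (Fin (m k)) (Fin (m' k)) F |
        ¬ ColumnsIndependentOver (boxSpan 𝕜 (entriesEquiv x.1) η) (systematic (x.2 k))} ≤
      ((Nat.card 𝕜 : ℝ) ^ η ^ Fintype.card (Fin d × Column m m')) ^ (m k + m' k) *
        ((Nat.card F : ℝ) ^ m k)⁻¹ :=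
  uniformProb_prod_le _ fun Λ =>
    calc uniformProb {R : ∀ k, Matrix (Fin (m k)) (Fin (m' k)) F |
          ¬ ColumnsIndependentOver (boxSpan 𝕜 (entriesEquiv Λ) η) (systematic (R k))}
        ≤ (Nat.card (boxSpan 𝕜 (entriesEquiv Λ) η) : ℝ) ^ Fintype.card (Fin (m k) ⊕ Fin (m' k)) *
            ((Nat.card F : ℝ) ^ Fintype.card (Fin (m k)))⁻¹ :=
          uniformProb_not_columnsIndependentOver_systematic_le _ k
      _ ≤ _ := by
          rw [Fintype.card_sum, Fintype.card_fin, Fintype.card_fin]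
          gcongr
          exact_mod_cast card_boxSpan_le (𝕜 := 𝕜) (entriesEquiv Λ)

theorem uniformProb_not_exists_boxIndependent_le {𝕜 F : Type} [Field 𝕜] [Finite 𝕜]
    [Field F] [Finite F] [Algebra 𝕜 F] (η : ℕ) :
    uniformProb {Λ : Instance F K d m m' | ¬ ∃ R, BoxIndependent 𝕜 η (Λ.shear R) R} ≤
      (Nat.card 𝕜 : ℝ) ^ η ^ Fintype.card (Fin d × Column m m') *
          (Fintype.card (Fin d × Column m m') * η / Nat.card F) +
        ∑ k, ((Nat.card 𝕜 : ℝ) ^ η ^ Fintype.card (Fin d × Column m m')) ^ (m k + m' k) *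
          ((Nat.card F : ℝ) ^ m k)⁻¹ := by
  let dependent : Set (Instance F K d m m') :=
    {Λ | ¬ LinearIndependent 𝕜 fun e : Fin d × Column m m' → Fin η =>
      aeval (entriesEquiv Λ) (boxMonomial 𝕜 e)}
  let related (k : Fin K) :
      Set (Instance F K d m m' × ∀ k, Matrix (Fin (m k)) (Fin (m' k)) F) :=
    {x | ¬ ColumnsIndependentOver (boxSpan 𝕜 (entriesEquiv x.1) η) (systematic (x.2 k))}
  have hcover : Prod.fst ⁻¹' {Λ : Instance F K d m m' | ¬ ∃ R, BoxIndependent 𝕜 η (Λ.shear R) R} ⊆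
      shearEquiv ⁻¹' (Prod.fst ⁻¹' dependent ∪ ⋃ k, related k) := by
    intro x hx
    by_contra hgood
    simp only [Set.mem_preimage, Set.mem_union, Set.mem_iUnion, not_or, not_exists] at hgood
    exact hx ⟨x.2, not_not.1 hgood.1, fun k => not_not.1 (hgood.2 k)⟩
  rw [← uniformProb_preimage_fst (β := ∀ k, Matrix (Fin (m k)) (Fin (m' k)) F)]
  calc _ ≤ uniformProb (shearEquiv ⁻¹' (Prod.fst ⁻¹' dependent ∪ ⋃ k, related k)) :=
        uniformProb_mono hcover
    _ = uniformProb (Prod.fst ⁻¹' dependent ∪ ⋃ k, related k) := uniformProb_preimage_equiv _ _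
    _ ≤ uniformProb (Prod.fst ⁻¹' dependent) + ∑ k, uniformProb (related k) :=
        (uniformProb_union_le _ _).trans (by gcongr; exact uniformProb_iUnion_le_sum related)
    _ ≤ _ := by
        rw [uniformProb_preimage_fst]
        gcongr with k
        · exact uniformProb_not_linearIndependent_boxMonomial_le η
        · exact uniformProb_not_columnsIndependentOver_boxSpan_le η k

theorem eventually_generic_exists_boxIndependent [Nonempty (Fin d × Column m m')] {c : ℝ}
    (hcm : ∀ k, (m k + m' k) * c < m k) {η : ℕ → ℕ}
    (hη : Tendsto (fun n => (η n : ℝ) ^ Fintype.card (Fin d × Column m m') / n) atTop (𝓝 c)) :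
    ∀ᶠ Λ in generic p K d m m', ∃ R, BoxIndependent (ZMod p) (η Λ.1) (Λ.2.shear R) R := by
  set W := Fintype.card (Fin d × Column m m')
  have hp : 1 < (p : ℝ) := by exact_mod_cast (Fact.out : p.Prime).one_lt
  have hc : c < 1 := by
    obtain ⟨_, k, _⟩ := Classical.arbitrary (Fin d × Column m m')
    by_contra! h
    have hle := le_mul_of_one_le_right (by positivity : (0 : ℝ) ≤ m k + m' k) h
    linarith [hcm k, (m' k).cast_nonneg (α := ℝ)]
  have hmonomials := (tendsto_mul_pow_mul_inv_pow_pow hp (a := fun n => η n ^ W) (b := 1)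
    (by simpa using hη) (by simpa using hc)).const_mul (W : ℝ)
  have hcolumns (k) := tendsto_mul_pow_mul_inv_pow_pow hp (a := fun n => η n ^ W * (m k + m' k))
    (b := m k) ((hη.mul_const ((m k : ℝ) + m' k)).congr fun n => by push_cast; ring)
    (by rw [mul_comm]; exact hcm k)
  have hlim := hmonomials.add (tendsto_finsetSum Finset.univ fun k _ => hcolumns k)
  rw [mul_zero, Finset.sum_const_zero, add_zero] at hlim
  refine eventually_whp_of_uniformProb_not_le hlim ?_
  filter_upwards [hη.eventually_le_const hc, eventually_ge_atTop 1] with n hηn hn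
  have hn1 : 1 ≤ (n : ℝ) := by exact_mod_cast hn
  have hηn' : (η n : ℝ) ≤ n := by
    rw [div_le_one (by positivity)] at hηn
    exact le_trans (by exact_mod_cast Nat.le_self_pow Fintype.card_ne_zero _) hηn
  refine (uniformProb_not_exists_boxIndependent_le (η n)).trans ?_
  rw [Nat.card_zmod, GaloisField.card p n (by lia)]
  push_cast
  refine add_le_add ?_ (Finset.sum_le_sum fun k _ => ?_)
  · calc (p : ℝ) ^ η n ^ W * (W * η n / p ^ n)
        = W * (η n * ((p : ℝ) ^ (η n ^ W) * (((p : ℝ) ^ n) ^ 1)⁻¹)) := by ring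
      _ ≤ _ := by gcongr
  · rw [pow_mul]
    exact le_mul_of_one_le_left (by positivity) hn1

theorem optimalCost_le_of_boxIndependent {n : ℕ} (hn : n ≠ 0) {η : ℕ}
    {Λ : Instance (GaloisField p n) K d m m'}
    {R : ∀ k, Matrix (Fin (m k)) (Fin (m' k)) (GaloisField p n)}
    (h : BoxIndependent (ZMod p) η (Λ.shear R) R) :
    optimalCost Λ ≤ d * ((η + 1) ^ Fintype.card (Fin d × Column m m') / n) +
      ∑ k, (m k - (m k + m' k) * ((η : ℝ) ^ Fintype.card (Fin d × Column m m') / n)) := by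
  obtain ⟨hmonomials, hR⟩ := h
  have hF : 1 < (Nat.card (GaloisField p n) : ℝ) := by exact_mod_cast Finite.one_lt_card
  have hlarge := card_boxSpan_le (𝕜 := ZMod p) (η := η + 1) (entriesEquiv (Λ.shear R))
  have hsmall := card_boxSpan hmonomials
  rw [Nat.card_zmod] at hlarge hsmall
  refine (optimalCost_le_of_columnsIndependentOver Λ R
    (fun i c v hv => mul_mem_boxSpan (i, c) hv) hR).trans ?_
  rw [hsmall, Nat.cast_pow, logb_card_galoisField_pow p hn]
  push_cast
  gcongr
  calc Real.logb (Nat.card (GaloisField p n)) _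
      ≤ Real.logb (Nat.card (GaloisField p n)) ((p : ℝ) ^ _) :=
        Real.logb_le_logb_of_le hF (by exact_mod_cast Nat.card_pos) (by exact_mod_cast hlarge)
    _ = _ := by
        rw [logb_card_galoisField_pow p hn]
        push_cast
        rfl

theorem eventually_generic_optimalCost_lt_of_forall_lt [Nonempty (Fin d × Column m m')] {c b : ℝ}
    (hc0 : 0 < c) (hcm : ∀ k, (m k + m' k) * c < m k)
    (hb : d * c + ∑ k, (m k - (m k + m' k) * c) < b) :
    ∀ᶠ Λ in generic p K d m m', optimalCost Λ.2 < b := by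
  obtain ⟨η, hη, hη'⟩ := exists_natCast_pow_div_tendsto hc0
    (Fintype.card_ne_zero (α := Fin d × Column m m'))
  have hcost := (hη'.const_mul (d : ℝ)).add (tendsto_finsetSum Finset.univ fun k _ =>
    (hη.const_mul ((m k : ℝ) + m' k)).const_sub (m k : ℝ))
  filter_upwards [eventually_generic_exists_boxIndependent hcm hη,
    tendsto_fst_whp.eventually (hcost.eventually_lt_const hb),
    tendsto_fst_whp.eventually (eventually_ne_atTop 0)] with Λ ⟨R, hR⟩ hlt hn
  exact (optimalCost_le_of_boxIndependent hn hR).trans_lt hlt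

end GenericAlignment

section GenericCostBounds

variable {p : ℕ} [Fact p.Prime] {K d : ℕ} {Δ : ℝ}

section Asymmetric

variable {m m' : Fin K → ℕ}

theorem isGenericCost_of_eventually_le (hle : ∀ᶠ Λ in generic p K d m m', optimalCost Λ.2 ≤ Δ)
    (hge : ∀ᶠ Λ in generic p K d m m', Δ ≤ optimalCost Λ.2) : IsGenericCost p K d m m' Δ :=
  isGenericCost_iff_tendsto.2 <|
    tendsto_const_nhds.congr' (hge.mp (hle.mono fun _ hle hge => hge.antisymm hle))

theorem isGenericCost_zero (h : ∀ k, d ≤ m' k) : IsGenericCost p K d m m' 0 :=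
  isGenericCost_of_eventually_le
    ((eventually_generic_optimalCost_le_sub h).mono fun Λ hΛ => by simpa using hΛ)
    (Eventually.of_forall fun Λ => optimalCost_nonneg Λ.2)

theorem isGenericCost_sub {k : Fin K} (hmin : ∀ j, m' k ≤ m' j) (hle : m' k ≤ d)
    (hge : d ≤ m k + m' k) : IsGenericCost p K d m m' (d - m' k) :=
  isGenericCost_of_eventually_le
    ((eventually_generic_optimalCost_le_sub hmin).mono fun Λ hΛ => by rwa [Nat.cast_sub hle] at hΛ)
    ((eventually_generic_min_sub_le_optimalCost {k}).mono fun Λ hΛ => by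
      rwa [Finset.sum_singleton, Finset.sum_singleton,
        min_eq_left (by exact_mod_cast hge)] at hΛ)

theorem isGenericCost_sum (h : ∑ k, (m k + m' k) ≤ d) :
    IsGenericCost p K d m m' (∑ k, (m k : ℝ)) :=
  isGenericCost_of_eventually_le (Eventually.of_forall fun Λ => optimalCost_le_sum Λ.2)
    ((eventually_generic_min_sub_le_optimalCost Finset.univ).mono fun Λ hΛ => by
      rwa [min_eq_right (by exact_mod_cast h), Finset.sum_add_distrib, add_sub_cancel_right] at hΛ)

end Asymmetric

variable {m m' : ℕ}

theorem eventually_generic_min_sub_mul_le_optimalCost {t : ℕ} (ht : t ≤ K) :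
    ∀ᶠ Λ in generic p K d (fun _ => m) (fun _ => m'),
      min (d : ℝ) (t * (m + m')) - t * m' ≤ optimalCost Λ.2 := by
  obtain ⟨T, -, rfl⟩ := Finset.exists_subset_card_eq (s := (Finset.univ : Finset (Fin K)))
    (n := t) (by simpa using ht)
  simpa only [Finset.sum_const, nsmul_eq_mul] using
    eventually_generic_min_sub_le_optimalCost (p := p) (d := d) (m := fun _ => m)
      (m' := fun _ => m') T

theorem eventually_generic_optimalCost_lt (hK : 0 < K) (hd : 0 < d) {b : ℝ}
    (hb : m * d / (m + m') < b) :
    ∀ᶠ Λ in generic p K d (fun _ => m) (fun _ => m'), optimalCost Λ.2 < b := by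
  rcases m.eq_zero_or_pos with rfl | hm
  · refine Eventually.of_forall fun Λ => (optimalCost_le_sum Λ.2).trans_lt ?_
    simpa using hb
  have : Nonempty (Fin d × Column (fun _ : Fin K => m) fun _ => m') :=
    ⟨⟨0, hd⟩, ⟨0, hK⟩, .inl ⟨0, hm⟩⟩
  have hN : (0 : ℝ) < m + m' := by positivity
  have hlim : Tendsto (fun c : ℝ => d * c + K * (m - (m + m') * c)) (𝓝[<] (m / (m + m')))
      (𝓝 (m * d / (m + m'))) := by
    refine (Continuous.tendsto' (by fun_prop) _ _ ?_).mono_left nhdsWithin_le_nhds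
    field_simp
    ring
  obtain ⟨c, hcost, hc0, hc⟩ := ((hlim.eventually_lt_const hb).and
    (Ioo_mem_nhdsLT (by positivity : 0 < (m : ℝ) / (m + m')))).exists
  refine eventually_generic_optimalCost_lt_of_forall_lt hc0 (fun _ => ?_) ?_
  · rwa [lt_div_iff₀' hN] at hc
  · simpa only [Finset.sum_const, Finset.card_univ, Fintype.card_fin, nsmul_eq_mul] using hcost

theorem IsGenericCost.le_mul_div (h : IsGenericCost p K d (fun _ => m) (fun _ => m') Δ)
    (hK : 0 < K) (hd : 0 < d) : Δ ≤ m * d / (m + m') :=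
  le_of_forall_gt_imp_ge_of_dense fun _b hb => le_of_tendsto (isGenericCost_iff_tendsto.1 h)
    ((eventually_generic_optimalCost_lt hK hd hb).mono fun _ => le_of_lt)

theorem IsGenericCost.min_sub_mul_le (h : IsGenericCost p K d (fun _ => m) (fun _ => m') Δ) {t : ℕ}
    (ht : t ≤ K) : min (d : ℝ) (t * (m + m')) - t * m' ≤ Δ :=
  ge_of_tendsto (isGenericCost_iff_tendsto.1 h) (eventually_generic_min_sub_mul_le_optimalCost ht)

theorem IsGenericCost.sub_mul_ceil_le (h : IsGenericCost p K d (fun _ => m) (fun _ => m') Δ)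
    (hN : 0 < m + m') (hK : (d : ℝ) / (m + m') ≤ K) : d - m' * (⌈(d : ℝ) / (m + m')⌉ : ℝ) ≤ Δ := by
  have hN' : (0 : ℝ) < m + m' := by exact_mod_cast hN
  have hle := h.min_sub_mul_le (Nat.ceil_le.2 hK)
  rwa [min_eq_left ((div_le_iff₀ hN').1 (Nat.le_ceil _)),
    natCast_ceil_eq_intCast_ceil (by positivity), mul_comm] at hle

theorem IsGenericCost.mul_floor_le (h : IsGenericCost p K d (fun _ => m) (fun _ => m') Δ)
    (hK : (d : ℝ) / (m + m') ≤ K) : m * (⌊(d : ℝ) / (m + m')⌋ : ℝ) ≤ Δ := by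
  have hfloor := Nat.floor_le (by positivity : 0 ≤ (d : ℝ) / (m + m'))
  have hle := h.min_sub_mul_le (Nat.cast_le.1 (hfloor.trans hK))
  rwa [min_eq_right (mul_le_of_le_div₀ (by positivity) (by positivity) hfloor),
    natCast_floor_eq_intCast_floor (by positivity), ← mul_sub, add_sub_cancel_right,
    mul_comm] at hle

theorem isGenericCost_mul_div_of_dvd (hd : 0 < d) (hdvd : m + m' ∣ d) (hK : d ≤ K * (m + m')) :
    IsGenericCost p K d (fun _ => m) (fun _ => m') (m * d / (m + m')) := by
  obtain ⟨t, rfl⟩ := hdvd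
  have hN : 0 < m + m' := Nat.pos_of_mul_pos_right hd
  have ht : 0 < t := Nat.pos_of_mul_pos_left hd
  have htK : t ≤ K := Nat.le_of_mul_le_mul_left (by rwa [mul_comm K] at hK) hN
  have hN' : ((m + m' : ℕ) : ℝ) ≠ 0 := by exact_mod_cast hN.ne'
  have hlower : (m : ℝ) * ((m + m') * t : ℕ) / (m + m') =
      min (((m + m') * t : ℕ) : ℝ) (t * (m + m')) - t * m' := by
    push_cast at hN' ⊢
    rw [mul_comm (t : ℝ) (m + m'), min_self]
    field_simp
    ring
  refine isGenericCost_iff_tendsto.2 (tendsto_order.2 ⟨fun b hb => ?_, fun b hb =>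
    eventually_generic_optimalCost_lt (ht.trans_le htK) hd hb⟩)
  exact (eventually_generic_min_sub_mul_le_optimalCost htK).mono fun Λ hΛ =>
    (hb.trans_eq hlower).trans_le hΛ

end GenericCostBounds

section GenericCapacity

theorem div_floor_le_two {x : ℝ} (hx : 1 ≤ x) : x / (⌊x⌋ : ℝ) ≤ 2 := by
  have hfloor : (1 : ℝ) ≤ ⌊x⌋ := by exact_mod_cast Int.le_floor.2 (by simpa using hx)
  rw [div_le_iff₀ (by linarith)]
  linarith [Int.lt_floor_add_one x]

theorem inv_ofReal_le_two_mul_inv_ofReal {a b : ℝ} (h : a ≤ 2 * b) :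
    (ENNReal.ofReal b)⁻¹ ≤ 2 * (ENNReal.ofReal a)⁻¹ := by
  have hle : ENNReal.ofReal a ≤ 2 * ENNReal.ofReal b := by
    simpa [ENNReal.ofReal_mul] using ENNReal.ofReal_le_ofReal h
  calc (ENNReal.ofReal b)⁻¹ = 2 * (2 * ENNReal.ofReal b)⁻¹ := by
        rw [ENNReal.mul_inv (by simp) (by simp), ← mul_assoc,
          ENNReal.mul_inv_cancel (by simp) (by simp), one_mul]
    _ ≤ 2 * (ENNReal.ofReal a)⁻¹ := by gcongr

variable {p : ℕ} [Fact p.Prime] {K d m m' : ℕ} {C : ENNReal}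

theorem IsGenericCapacity.inv_le (h : IsGenericCapacity p K d (fun _ => m) (fun _ => m') C)
    (hK : 0 < K) (hd : 0 < d) : (ENNReal.ofReal (m * d / (m + m')))⁻¹ ≤ C := by
  obtain ⟨Δ, hΔ, rfl⟩ := h
  gcongr
  exact hΔ.le_mul_div hK hd

theorem IsGenericCapacity.le_two_mul_inv
    (h : IsGenericCapacity p K d (fun _ => m) (fun _ => m') C)
    (hd : 1 ≤ (d : ℝ) / (m + m')) (hK : (d : ℝ) / (m + m') ≤ K) :
    C ≤ 2 * (ENNReal.ofReal (m * d / (m + m')))⁻¹ := by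
  obtain ⟨Δ, hΔ, rfl⟩ := h
  refine inv_ofReal_le_two_mul_inv_ofReal ?_
  have hfloor : (0 : ℝ) < ⌊(d : ℝ) / (m + m')⌋ := by exact_mod_cast Int.floor_pos.2 hd
  calc (m * d / (m + m') : ℝ) = m * (d / (m + m')) := mul_div_assoc _ _ _
    _ ≤ m * (2 * ⌊(d : ℝ) / (m + m')⌋) := by
        gcongr
        exact (div_le_iff₀ hfloor).1 (div_floor_le_two hd)
    _ = 2 * (m * ⌊(d : ℝ) / (m + m')⌋) := by ring
    _ ≤ 2 * Δ := by
        gcongr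
        exact hΔ.mul_floor_le hK

end GenericCapacity

end LCBC

theorem mainTheorem5 (p : ℕ) [Fact p.Prime] (K d m m' : ℕ) (hK : 1 ≤ K) :
    (d ≤ m' → LCBC.IsGenericCost p K d (fun _ => m) (fun _ => m') 0) ∧
    (m' ≤ d → d ≤ m + m' →
      LCBC.IsGenericCost p K d (fun _ => m) (fun _ => m') ((d : ℝ) - (m' : ℝ))) ∧
    (K * (m + m') ≤ d →
      LCBC.IsGenericCost p K d (fun _ => m) (fun _ => m') ((K : ℝ) * (m : ℝ))) ∧
    (1 < (d : ℝ) / ((m : ℝ) + (m' : ℝ)) → (d : ℝ) / ((m : ℝ) + (m' : ℝ)) ≤ (K : ℝ) →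
      -- bounds on the generic cost, if it exists
      (∀ Δg : ℝ, LCBC.IsGenericCost p K d (fun _ => m) (fun _ => m') Δg →
        max ((d : ℝ) - (m' : ℝ) * (⌈(d : ℝ) / ((m : ℝ) + (m' : ℝ))⌉ : ℝ))
            ((m : ℝ) * (⌊(d : ℝ) / ((m : ℝ) + (m' : ℝ))⌋ : ℝ)) ≤ Δg ∧
          Δg ≤ (m : ℝ) * (d : ℝ) / ((m : ℝ) + (m' : ℝ))) ∧
      -- the generic cost exists if `m + m'` divides `d`
      (m + m' ∣ d → LCBC.IsGenericCost p K d (fun _ => m) (fun _ => m')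
        ((m : ℝ) * (d : ℝ) / ((m : ℝ) + (m' : ℝ)))) ∧
      -- the ratio of the upper bound to the lower bound
      (0 < m →
        ((m : ℝ) * (d : ℝ) / ((m : ℝ) + (m' : ℝ))) /
            ((m : ℝ) * (⌊(d : ℝ) / ((m : ℝ) + (m' : ℝ))⌋ : ℝ)) =
          ((d : ℝ) / ((m : ℝ) + (m' : ℝ))) / (⌊(d : ℝ) / ((m : ℝ) + (m' : ℝ))⌋ : ℝ)) ∧
      ((d : ℝ) / ((m : ℝ) + (m' : ℝ))) / (⌊(d : ℝ) / ((m : ℝ) + (m' : ℝ))⌋ : ℝ) ≤ 2 ∧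
      -- the generic capacity, if it exists, is determined within a factor of `2`
      (∀ C : ENNReal, LCBC.IsGenericCapacity p K d (fun _ => m) (fun _ => m') C →
        (ENNReal.ofReal ((m : ℝ) * (d : ℝ) / ((m : ℝ) + (m' : ℝ))))⁻¹ ≤ C ∧
          C ≤ 2 * (ENNReal.ofReal ((m : ℝ) * (d : ℝ) / ((m : ℝ) + (m' : ℝ))))⁻¹)) := by
  refine ⟨fun hd => LCBC.isGenericCost_zero fun _ => hd,
    fun hle hge => LCBC.isGenericCost_sub (k := ⟨0, hK⟩) (fun _ => le_rfl) hle hge,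
    fun hd => ?_, fun hx hxK => ?_⟩
  · simpa using LCBC.isGenericCost_sum (p := p) (m := fun _ : Fin K => m) (m' := fun _ => m')
      (by simpa using hd)
  have hx0 : (d : ℝ) / (m + m') ≠ 0 := (one_pos.trans hx).ne'
  have hd : 0 < d := Nat.pos_of_ne_zero fun h => hx0 (by simp [h])
  have hN : 0 < m + m' := Nat.pos_of_ne_zero fun h => hx0 (by rw [← Nat.cast_add, h]; simp)
  have hdK : d ≤ K * (m + m') := by
    rw [div_le_iff₀ (by exact_mod_cast hN)] at hxK
    exact_mod_cast hxK
  refine ⟨fun Δg hΔ => ⟨max_le (hΔ.sub_mul_ceil_le hN hxK) (hΔ.mul_floor_le hxK),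
      hΔ.le_mul_div hK hd⟩, fun hdvd => LCBC.isGenericCost_mul_div_of_dvd hd hdvd hdK,
    fun hm => ?_, LCBC.div_floor_le_two hx.le,
    fun C hC => ⟨hC.inv_le hK hd, hC.le_two_mul_inv hx.le hxK⟩⟩
  rw [mul_div_assoc]
  exact mul_div_mul_left _ _ (by exact_mod_cast hm.ne')
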